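/- Write $\mathbb{CP}^1=\mathrm{SU}(2)/\mathrm{U}(1)$, where $\mathrm{U}(1)=\{\mathrm{diag}(u,\bar u):|u|=1\}$. Let $\mathfrak m\subset\mathfrak{su}(2)$ be the complement of $\mathfrak u(1)$ spanned over $\mathbb R$ by $E_1=\begin{pmatrix}0&1\\-1&0\end{pmatrix}$ and $E_2=\begin{pmatrix}0&i\\ i&0\end{pmatrix}$, equipped with the symplectic form with $\omega_0(E_1,E_2)=1$, the complex structure with $J_0E_1=E_2$, and the inner product $g_0(X,Y)=\omega_0(X,J_0Y)$ (for which $E_1,E_2$ are orthonormal). Let $\kappa:\mathrm U(1)\to\mathrm{Sp}(\mathfrak m)$ be the isotropy representation, i.e. the restriction of the adjoint representation. Symplectic Clifford multiplication is given by the unbounded operators $(E_1\cdot f)(t)=i\,t\,f(t)$ and $E_2\cdot f=f'$ on $L^2(\mathbb R)$, extended linearly to $X\in\mathfrak m$ (each $X\cdot$ being taken on its maximal, distributional domain). Let $\mathrm{Mp}(\mathfrak m)$ be the connected double cover of $\mathrm{Sp}(\mathfrak m)$, acting on $L^2(\mathbb R)$ by the metaplectic representation, so that $a(X\cdot f)=(\rho(a)X)\cdot(af)$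 with $\rho:\mathrm{Mp}(\mathfrak m)\to\mathrm{Sp}(\mathfrak m)$ the covering. Let $\tilde\kappa:\mathrm U(1)\to\mathrm{Mp}(\mathfrak m)$ be a lift of $\kappa$, i.e. a continuous homomorphism with $\rho\circ\tilde\kappa=\kappa$ (a metaplectic structure of $\mathbb{CP}^1$), and let $\lambda$ be the resulting unitary representation of $\mathrm U(1)$ on $L^2(\mathbb R)$. The symplectic spinor fields are the smooth maps $\varphi:\mathrm{SU}(2)\to L^2(\mathbb R)$ with $\varphi(gh)=\lambda(h^{-1})\varphi(g)$ for $h\in \mathrm U(1)$; they form the space $\Gamma(Q)$ of smooth sections of the spinor bundle $Q$. With the spinor derivative $X(\varphi)(g)=\frac{d}{dt}\big|_{t=0}\varphi(g\exp(tX))$ for $X\in\mathfrak m$, the two symplectic Dirac operators are obtained by composing the spinor derivative with the identification $T^*M\cong TM$ induced by $\omega_0$, respectively by $g_0$, and with Clifford multiplication: $$\mathcal D\varphi=E_1\cdot E_2(\varphi)-E_2\cdot E_1(\varphi),\qquad \tilde{\mathcal D}\varphi=E_1\cdot E_1(\varphi)+E_2\cdot E_2(\varphi),$$ defined for those $\varphi\in\Gamma(Q)$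 for which the Clifford products exist in $L^2(\mathbb R)$ at every point and the result lies in $\Gamma(Q)$. Let $L^2(Q)$ be the closure of $\Gamma(Q)$ in $L^2(\mathrm{SU}(2);L^2(\mathbb R))$ with respect to Haar measure. **Corollary.** The spectrum of each of the symplectic Dirac operators $\mathcal D$ and $\tilde{\mathcal D}$ on $\mathbb{CP}^1$ is unbounded above and below. Precisely, for each of $\mathcal D$ and $\tilde{\mathcal D}$, the set of real numbers in the spectrum of its closure in the Hilbert space $L^2(Q)$ is bounded neither above nor below; and already the set of its real eigenvalues with eigenvectors in $\Gamma(Q)$ is bounded neither above nor below. -/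

import Mathlib

open MeasureTheory
open scoped Matrix ContDiff SchwartzMap MatrixGroups

namespace CP1

/-! ### The symmetric space `CP¹ = SU(2)/U(1)` -/

/-- The group `G = SU(2)`, with the topology of a subspace of the `2 × 2` complex matrices. -/
abbrev SU2 : Type := Matrix.specialUnitaryGroup (Fin 2) ℂ

instance instIsTopologicalGroupSU2 : IsTopologicalGroup SU2 where
  continuous_mul := continuous_mul
  continuous_inv := Continuous.subtype_mk (continuous_star.comp continuous_subtype_val) _

instance instCompactSpaceSU2 : CompactSpace SU2 := by
  have hset : {A : Matrix (Fin 2) (Fin 2) ℂ | A ∈ Matrix.specialUnitaryGroup (Fin 2) ℂ} =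
      {A | A * star A = 1} ∩ {A | A.det = 1} := by
    ext A
    simp [Matrix.mem_specialUnitaryGroup_iff, Matrix.mem_unitaryGroup_iff]
  have hclosed : IsClosed
      {A : Matrix (Fin 2) (Fin 2) ℂ | A ∈ Matrix.specialUnitaryGroup (Fin 2) ℂ} := by
    rw [hset]
    exact (isClosed_eq (continuous_id.mul continuous_star) continuous_const).inter
      (isClosed_eq (Continuous.matrix_det continuous_id) continuous_const)
  have hbox : IsCompact (Set.univ.pi fun _ : Fin 2 => Set.univ.pi fun _ : Fin 2 =>
      Metric.closedBall (0 : ℂ) 1) :=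
    isCompact_univ_pi fun _ => isCompact_univ_pi fun _ => isCompact_closedBall _ _
  refine isCompact_iff_compactSpace.mp (hbox.of_isClosed_subset hclosed fun A hA => ?_)
  intro i _ j _
  simpa using entry_norm_bound_of_unitary hA.1 i j

noncomputable instance instMeasurableSpaceSU2 : MeasurableSpace SU2 := borel SU2

instance instBorelSpaceSU2 : BorelSpace SU2 := ⟨rfl⟩

/-- The subgroup `H = U(1)` of `SU(2)`: `exp (t E₀) = diag (e^{it}, e^{-it})` with
`E₀ = diag (i, -i)`. -/
noncomputable def torus (u : Circle) : SU2 :=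
  ⟨!![(u : ℂ), 0; 0, star (u : ℂ)], by
    have h : (u : ℂ) * star (u : ℂ) = 1 := by
      simp [Complex.mul_conj, Complex.normSq_eq_norm_sq, Circle.norm_coe]
    have h' : star (u : ℂ) * (u : ℂ) = 1 := by rw [mul_comm]; exact h
    rw [Matrix.mem_specialUnitaryGroup_iff, Matrix.mem_unitaryGroup_iff]
    refine ⟨?_, ?_⟩
    · ext i j
      fin_cases i <;> fin_cases j <;>
        simp [Matrix.mul_apply, Matrix.star_apply, Fin.sum_univ_two] <;>
        first | exact h | exact h'
    · simpa [Matrix.det_fin_two_of] using h⟩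

/-- The element `x₀ E₁ + x₁ E₂` of the complement `𝔪` of `𝔲(1)` in `𝔰𝔲(2)`, where
`E₁ = !![0, 1; -1, 0]` and `E₂ = !![0, i; i, 0]`. Below, `𝔪` is identified with
`Fin 2 → ℝ` through the basis `E₁, E₂`. -/
noncomputable def mElem (x : Fin 2 → ℝ) : Matrix (Fin 2) (Fin 2) ℂ :=
  (x 0 : ℂ) • !![0, 1; -1, 0] + (x 1 : ℂ) • !![0, Complex.I; Complex.I, 0]

theorem mElem_eq (x : Fin 2 → ℝ) :
    mElem x = !![0, x 0 + x 1 * Complex.I; -x 0 + x 1 * Complex.I, 0] := by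
  ext i j
  fin_cases i <;> fin_cases j <;> simp [mElem]

theorem exp_mElem_mem (x : Fin 2 → ℝ) :
    NormedSpace.exp (mElem x) ∈ Matrix.specialUnitaryGroup (Fin 2) ℂ := by
  rw [Matrix.mem_specialUnitaryGroup_iff]
  have hskew : (mElem x)ᴴ = -mElem x := by
    rw [mElem_eq]
    ext i j
    fin_cases i <;> fin_cases j <;> simp [Matrix.conjTranspose_apply] <;> ring
  constructor
  · rw [Matrix.mem_unitaryGroup_iff, Matrix.star_eq_conjTranspose, ← Matrix.exp_conjTranspose,
      hskew, Matrix.exp_neg]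
    exact Matrix.mul_nonsing_inv _ ((Matrix.isUnit_iff_isUnit_det _).mp (Matrix.isUnit_exp _))
  · have hJ : IsUnit (!![0, 1; -1, 0] : Matrix (Fin 2) (Fin 2) ℂ) := by
      rw [Matrix.isUnit_iff_isUnit_det]
      simp [Matrix.det_fin_two_of]
    have hJi : (!![0, 1; -1, 0] : Matrix (Fin 2) (Fin 2) ℂ)⁻¹ = !![0, -1; 1, 0] := by
      apply Matrix.inv_eq_right_inv
      ext i j
      fin_cases i <;> fin_cases j <;> simp [Matrix.mul_apply, Fin.sum_univ_two]
    have hc : !![0, 1; -1, 0] * (-mElem x) * (!![0, 1; -1, 0] : Matrix (Fin 2) (Fin 2) ℂ)⁻¹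
        = (mElem x)ᵀ := by
      rw [hJi, mElem_eq]
      ext i j
      fin_cases i <;> fin_cases j <;> simp [Matrix.mul_apply, Fin.sum_univ_two]
    have hexp := Matrix.exp_conj (!![0, 1; -1, 0] : Matrix (Fin 2) (Fin 2) ℂ) (-mElem x) hJ
    rw [hc, Matrix.exp_transpose, Matrix.exp_neg, hJi] at hexp
    set M := NormedSpace.exp (mElem x) with hM
    have hu : IsUnit M.det := (Matrix.isUnit_iff_isUnit_det _).mp (Matrix.isUnit_exp _)
    have h2 : Mᵀ * !![0, 1; -1, 0] * M = !![0, 1; -1, 0] := by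
      have h3 : (!![0, -1; 1, 0] : Matrix (Fin 2) (Fin 2) ℂ) * !![0, 1; -1, 0] = 1 := by
        ext i j
        fin_cases i <;> fin_cases j <;> simp [Matrix.mul_apply, Fin.sum_univ_two]
      rw [hexp, Matrix.mul_assoc _ _ !![0, 1; -1, 0], h3, Matrix.mul_one, Matrix.mul_assoc,
        Matrix.nonsing_inv_mul _ hu, Matrix.mul_one]
    have h4 := congrFun (congrFun h2 0) 1
    rw [Matrix.det_fin_two]
    simp [Matrix.mul_apply, Fin.sum_univ_two, Matrix.transpose_apply] at h4
    linear_combination h4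

/-- The exponential map `𝔪 → SU(2)`. -/
noncomputable def expM (x : Fin 2 → ℝ) : SU2 := ⟨NormedSpace.exp (mElem x), exp_mElem_mem x⟩

/-- The isotropy representation `κ : U(1) → Sp(𝔪)`. In dimension two, `Sp(𝔪) = SL(2, ℝ)`. -/
noncomputable def isotropy (u : Circle) : SL(2, ℝ) :=
  ⟨!![((u : ℂ) ^ 2).re, -((u : ℂ) ^ 2).im; ((u : ℂ) ^ 2).im, ((u : ℂ) ^ 2).re], by
    have h : Complex.normSq ((u : ℂ) ^ 2) = 1 := by simp [Complex.normSq_eq_norm_sq, Circle.norm_coe]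
    rw [Complex.normSq_apply] at h
    rw [Matrix.det_fin_two_of]
    linarith⟩

/-- `κ` is the adjoint representation of `H` on `𝔪`. -/
theorem torus_conj_mElem (u : Circle) (x : Fin 2 → ℝ) :
    (torus u : Matrix (Fin 2) (Fin 2) ℂ) * mElem x * ((torus u)⁻¹ : SU2) =
      mElem ((isotropy u : Matrix (Fin 2) (Fin 2) ℝ) *ᵥ x) := by
  have hinv : (((torus u)⁻¹ : SU2) : Matrix (Fin 2) (Fin 2) ℂ) = star (torus u).1 := rfl
  rw [hinv, mElem_eq, mElem_eq]
  have hu : (u : ℂ) = (u : ℂ).re + (u : ℂ).im * Complex.I := (Complex.re_add_im _).symm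
  ext i j
  fin_cases i <;> fin_cases j <;>
    simp [torus, isotropy, Matrix.mul_apply, Matrix.star_apply, Fin.sum_univ_two,
      Matrix.mulVec, dotProduct, Complex.ext_iff, pow_two] <;>
    constructor <;> ring

/-- The matrix of the symplectic form `ω₀` on `𝔪`: `ω₀(x, y) = xᵀ Ω y`, so that
`(E₁, E₂)` is a symplectic basis. -/
def omega0 : Matrix (Fin 2) (Fin 2) ℝ := !![0, 1; -1, 0]

/-- The matrix of the complex structure `J₀` on `𝔪`: `J₀ E₁ = E₂`, `J₀ E₂ = -E₁`. -/
def J0 : Matrix (Fin 2) (Fin 2) ℝ := !![0, -1; 1, 0]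

/-- The matrix of the inner product `g₀(x, y) = ω₀(x, J₀ y)` on `𝔪`. -/
def g0 : Matrix (Fin 2) (Fin 2) ℝ := omega0 * J0

/-! ### Symplectic Clifford multiplication, metaplectic group, spinor fields -/

/-- The Hilbert space `L²(ℝ)`. -/
abbrev L2R : Type := Lp ℂ 2 (volume : Measure ℝ)

/-- `IsClifford x f h` says that the symplectic Clifford product `X · f` of
`X = x₀ E₁ + x₁ E₂ ∈ 𝔪` and `f ∈ L²(ℝ)` exists in `L²(ℝ)` and is `h`. Here `E₁ · f = i t f(t)` and
`E₂ · f = f'`, the unbounded operator `X ·` being taken on its maximal domain in `L²(ℝ)`, i.e.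
`h = i x₀ t f + x₁ f'` as tempered distributions. -/
def IsClifford (x : Fin 2 → ℝ) (f h : L2R) : Prop :=
  ∀ ψ : 𝓢(ℝ, ℂ), ∫ t : ℝ, h t * ψ t =
    ∫ t : ℝ, f t * (x 0 * Complex.I * t * ψ t - x 1 * deriv ψ t)

/-- The unitary operator `U` on `L²(ℝ)` lies over `A ∈ Sp(𝔪)`: it intertwines the Clifford
multiplications, `U (X · f) = (A X) · (U f)`. -/
def Covers (U : L2R ≃ₗᵢ[ℂ] L2R) (A : SL(2, ℝ)) : Prop :=
  ∀ (x : Fin 2 → ℝ) (f h : L2R),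
    IsClifford x f h ↔ IsClifford ((A : Matrix (Fin 2) (Fin 2) ℝ) *ᵥ x) (U f) (U h)

/-- The group `Mpᶜ` of all unitary operators that lie over some element of `Sp(𝔪)`. It is a
central extension of `Sp(𝔪)` by the group of scalars of modulus one. -/
noncomputable def mpc : Subgroup (L2R ≃ₗᵢ[ℂ] L2R) where
  carrier := {U | ∃ A : SL(2, ℝ), Covers U A}
  one_mem' := ⟨1, fun x f h => by simp⟩
  mul_mem' := by
    rintro U V ⟨A, hA⟩ ⟨B, hB⟩
    refine ⟨A * B, fun x f h => ?_⟩
    rw [hB x f h, hA _ (V f) (V h), Matrix.mulVec_mulVec, Matrix.SpecialLinearGroup.coe_mul]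
    rfl
  inv_mem' := by
    rintro U ⟨A, hA⟩
    refine ⟨A⁻¹, fun x f h => ?_⟩
    rw [hA _ (U⁻¹ f) (U⁻¹ h), Matrix.mulVec_mulVec, ← Matrix.SpecialLinearGroup.coe_mul,
      mul_inv_cancel, Matrix.SpecialLinearGroup.coe_one, Matrix.one_mulVec]
    have hU : ∀ v, U (U⁻¹ v) = v := fun v => U.apply_symm_apply v
    rw [hU, hU]

/-- The metaplectic group `Mp(𝔪)`, realised as a group of unitary operators by means of the
(faithful) metaplectic representation: the connected double cover of `Sp(𝔪)` inside `Mpᶜ` is the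
commutator subgroup of `Mpᶜ`. -/
noncomputable def metaplecticGroup : Subgroup (L2R ≃ₗᵢ[ℂ] L2R) := ⁅mpc, mpc⁆

/-- A lift `κ̃ : U(1) → Mp(𝔪)` of the isotropy representation, i.e. a continuous homomorphism that
lies over `κ`; this is the same as a metaplectic structure on `CP¹`. Since `Mp(𝔪)` is
realised on `L²(ℝ)`, `hom` is at the same time the representation `λ` of `U(1)` on `L²(ℝ)` that
defines the spinor bundle. -/
structure MetaplecticLift where
  hom : Circle →* metaplecticGroup
  continuous_hom : ∀ f : L2R, Continuous fun u => (hom u : L2R ≃ₗᵢ[ℂ] L2R) f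
  covers : ∀ u, Covers (hom u) (isotropy u)

/-- `Γ(Q)`: the symplectic spinor fields, i.e. the smooth maps `φ : SU(2) → L²(ℝ)` such that
`φ (g h) = λ(h⁻¹) φ(g)` for `h ∈ U(1)`. A map on the closed submanifold `SU(2)` of the space of
matrices is smooth iff it is the restriction of a smooth map. -/
def spinorFields (κt : MetaplecticLift) : Set (SU2 → L2R) :=
  {φ | (∃ F : (Fin 2 → Fin 2 → ℂ) → L2R, ContDiff ℝ ∞ F ∧ ∀ g : SU2, φ g = F fun i j => g.1 i j) ∧
    ∀ (g : SU2) (u : Circle), φ (g * torus u) = (κt.hom u⁻¹ : L2R ≃ₗᵢ[ℂ] L2R) (φ g)}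

/-- The spinor derivative `X(φ)(g) = dφ(dL_g X)` in the direction of `X ∈ 𝔪`. -/
noncomputable def spinorDeriv (x : Fin 2 → ℝ) (φ : SU2 → L2R) (g : SU2) : L2R :=
  deriv (fun t : ℝ => φ (g * expM (t • x))) 0

/-- The isomorphism `𝔪* → 𝔪` given by a nondegenerate bilinear form `B` on `𝔪`, on the dual basis
`E¹, E²`: the vector `v` with `B(v, ·) = Eⁱ`. -/
noncomputable def sharp (B : Matrix (Fin 2) (Fin 2) ℝ) (i : Fin 2) : Fin 2 → ℝ := B⁻¹ i

/-- `IsDirac B φ η`: the composition of the spinor derivative `Γ(Q) → Γ(T*M ⊗ Q)`, of the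
identification `T*M → TM` given by the form `B`, and of Clifford multiplication `TM ⊗ Q → Q`
is defined at `φ`, and its value is `η`. For `B = ω₀` this is
`η = 𝒟 φ = E₁ · E₂(φ) - E₂ · E₁(φ)`; for `B = g₀` it is `η = 𝒟̃ φ = E₁ · E₁(φ) + E₂ · E₂(φ)`. -/
def IsDirac (B : Matrix (Fin 2) (Fin 2) ℝ) (φ η : SU2 → L2R) : Prop :=
  ∀ g : SU2, ∃ h : Fin 2 → L2R,
    (∀ i, IsClifford (sharp B i) (spinorDeriv (Pi.single i 1) φ g) (h i)) ∧ η g = ∑ i, h i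

/-- The eigenvalues of the symplectic Dirac operator on `Γ(Q)` given by `B`. -/
def diracEigenvalues (κt : MetaplecticLift) (B : Matrix (Fin 2) (Fin 2) ℝ) : Set ℂ :=
  {z | ∃ φ ∈ spinorFields κt, φ ≠ 0 ∧ IsDirac B φ (z • φ)}

/-! ### The spectrum in the Hilbert space of square integrable sections -/

/-- The Hilbert space `L²(Q)`: the closure of (the classes of) the spinor fields in the space
of square integrable maps `SU(2) → L²(ℝ)`. -/
noncomputable def spinorL2 (κt : MetaplecticLift) :
    Submodule ℂ (Lp L2R 2 (Measure.haar : Measure SU2)) :=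
  (Submodule.span ℂ {Φ : Lp L2R 2 (Measure.haar : Measure SU2) |
    ∃ φ ∈ spinorFields κt,
    (Φ : SU2 → L2R) =ᵐ[(Measure.haar : Measure SU2)] φ}).topologicalClosure

/-- The graph, in `L²(Q) × L²(Q)`, of the symplectic Dirac operator on `Γ(Q)` given by `B`. -/
def diracGraph (κt : MetaplecticLift) (B : Matrix (Fin 2) (Fin 2) ℝ) :
    Set (spinorL2 κt × spinorL2 κt) :=
  {p | ∃ φ ∈ spinorFields κt, ∃ η ∈ spinorFields κt, IsDirac B φ η ∧
    (p.1.1 : SU2 → L2R) =ᵐ[(Measure.haar : Measure SU2)] φ ∧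
    (p.2.1 : SU2 → L2R) =ᵐ[(Measure.haar : Measure SU2)] η}

/-- The spectrum of the closure `T` of the unbounded operator with graph `S`: the complex numbers
`z` for which `T - z` has no bounded everywhere defined inverse `R`. -/
def spectrumOfGraph {E : Type*} [NormedAddCommGroup E] [NormedSpace ℂ E] (S : Set (E × E)) :
    Set ℂ :=
  {z | ¬ ∃ R : E →L[ℂ] E, (∀ u, (R u, u + z • R u) ∈ closure S) ∧
    ∀ p ∈ closure S, R (p.2 - z • p.1) = p.1}

/-- The spectrum of the symplectic Dirac operator given by `B` in the Hilbert space `L²(Q)`. -/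
def diracSpectrum (κt : MetaplecticLift) (B : Matrix (Fin 2) (Fin 2) ℝ) : Set ℂ :=
  spectrumOfGraph (diracGraph κt B)

end CP1

namespace CP1

/-! Let h_k = H_k(t) exp(-t²/2) be the Hermite functions. The combinations -iE₁ + E₂ and -iE₁ - E₂
act on L²(ℝ) as t + d/dt and t - d/dt, and κ(u) multiplies the second by u². An operator over κ(u)
therefore preserves the line of h_0, the kernel of t + d/dt, and its eigenvalue on h_k is u^{2k}
times that on h_0. Continuous characters of the circle being powers, every lift acts on h_k by
u^{m+2k} for one integer m (`MetaplecticLift.exists_weight`).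

Write x, y for the first row of g ∈ SU(2). If M = N + m, the sections x^{N-k} y^{M+k} h_k with 0 ≤ k
≤ N are equivariant. Each Dirac operator sends such a section to a combination of its neighbours k ±
1 (`isDirac_hermiteSection`), so on their span it is tridiagonal with zero diagonal. For both
operators the products of opposite off-diagonal entries are 2(k+1)(M+k+1)(N-k) > 0. Hence the matrix
is similar to a real symmetric Jacobi matrix, whose largest eigenvalue is at least its first
off-diagonal entry √(2N(M+1)) (`exists_eigenvalue_recurrence`), and this grows without bound with N.
Alternating signs of the coefficients turn an eigenvalue r into -r.

These eigensections are continuous and nonzero, hence nonzero in L², so their eigenvalues also lie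
in the spectrum of the closure. -/

/-! ### Polynomials times the Gaussian, as Schwartz functions and in L²(ℝ) -/

open Polynomial in
/-- The Schwartz function `p(t) exp (-t² / 2)` given by a polynomial `p`. -/
noncomputable def polyGaussFun (p : ℂ[X]) (t : ℝ) : ℂ := p.eval (t : ℂ) * (Real.exp (-(t ^ 2 / 2)) : ℝ)

theorem hasDerivAt_polyGaussFun (p : Polynomial ℂ) (t : ℝ) :
    HasDerivAt (polyGaussFun p) (polyGaussFun (p.derivative - Polynomial.X * p) t) t := by
  have h1 : HasDerivAt (fun t : ℝ => p.eval (t : ℂ)) (p.derivative.eval (t : ℂ)) t :=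
    (p.hasDerivAt (t : ℂ)).comp_ofReal
  have h2 : HasDerivAt (fun t : ℝ => Real.exp (-(t ^ 2 / 2))) (Real.exp (-(t ^ 2 / 2)) * (-t)) t := by
    have h : HasDerivAt (fun t : ℝ => -(t ^ 2 / 2)) (-t) t := by
      refine ((hasDerivAt_pow 2 t).div_const 2).neg.congr_deriv ?_
      simp
    exact h.exp
  refine (h1.mul h2.ofReal_comp).congr_deriv ?_
  simp only [polyGaussFun, Polynomial.eval_sub, Polynomial.eval_mul, Polynomial.eval_X]
  push_cast
  ring

theorem deriv_polyGaussFun (p : Polynomial ℂ) :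
    deriv (polyGaussFun p) = polyGaussFun (p.derivative - Polynomial.X * p) :=
  funext fun t => (hasDerivAt_polyGaussFun p t).deriv

/-- Differentiation only replaces p by p' - Xp, so the induction on the order runs over all
polynomials at once. -/
theorem contDiff_polyGaussFun (p : Polynomial ℂ) : ContDiff ℝ ∞ (polyGaussFun p) := by
  refine contDiff_infty.2 fun n => ?_
  induction n generalizing p with
  | zero => exact contDiff_zero.2 (continuous_iff_continuousAt.2 fun t =>
      (hasDerivAt_polyGaussFun p t).continuousAt)
  | succ n ih =>
    rw [Nat.cast_succ]
    refine contDiff_succ_iff_deriv.2 ⟨fun t => (hasDerivAt_polyGaussFun p t).differentiableAt,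
      fun h => absurd h (by simp), ?_⟩
    rw [deriv_polyGaussFun]
    exact ih _

theorem exists_iteratedDeriv_polyGaussFun (p : Polynomial ℂ) (n : ℕ) :
    ∃ q, iteratedDeriv n (polyGaussFun p) = polyGaussFun q := by
  induction n with
  | zero => exact ⟨p, iteratedDeriv_zero⟩
  | succ n ih =>
    obtain ⟨q, hq⟩ := ih
    exact ⟨_, by rw [iteratedDeriv_succ, hq, deriv_polyGaussFun]⟩

/-- One term of the exponential series gives s^m / m! ≤ exp s at s = t²/2; combine it with |t|^m ≤ 1
+ t^{2m}. -/
theorem pow_mul_exp_neg_sq_le (m : ℕ) (t : ℝ) :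
    |t| ^ m * Real.exp (-(t ^ 2 / 2)) ≤ 1 + 2 ^ m * m.factorial := by
  have h1 : (t ^ 2 / 2) ^ m / m.factorial ≤ Real.exp (t ^ 2 / 2) :=
    Real.pow_div_factorial_le_exp _ (by positivity) m
  have h2 : |t| ^ m ≤ 1 + (t ^ 2) ^ m := by
    rw [← sq_abs, ← pow_mul, mul_comm 2 m, pow_mul]
    nlinarith [sq_nonneg (|t| ^ m - 1), pow_nonneg (abs_nonneg t) m]
  have h3 : (t ^ 2) ^ m ≤ 2 ^ m * m.factorial * Real.exp (t ^ 2 / 2) := by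
    rw [div_le_iff₀ (by positivity), div_pow, div_le_iff₀ (by positivity)] at h1
    linarith
  have h4 : 1 ≤ Real.exp (t ^ 2 / 2) := Real.one_le_exp (by positivity)
  rw [Real.exp_neg, ← div_eq_mul_inv, div_le_iff₀ (Real.exp_pos _)]
  nlinarith

theorem exists_bound_polyGaussFun (p : Polynomial ℂ) (k : ℕ) :
    ∃ C : ℝ, ∀ t, |t| ^ k * ‖polyGaussFun p t‖ ≤ C := by
  refine ⟨∑ i ∈ Finset.range (p.natDegree + 1),
    ‖p.coeff i‖ * (1 + 2 ^ (k + i) * (k + i).factorial), fun t => ?_⟩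
  rw [polyGaussFun, norm_mul, Complex.norm_real, Real.norm_of_nonneg (Real.exp_pos _).le,
    Polynomial.eval_eq_sum_range, ← mul_assoc]
  calc _ ≤ |t| ^ k * (∑ i ∈ Finset.range (p.natDegree + 1), ‖p.coeff i‖ * |t| ^ i) *
        Real.exp (-(t ^ 2 / 2)) := by
        gcongr
        refine (norm_sum_le _ _).trans_eq (Finset.sum_congr rfl fun i _ => ?_)
        simp
    _ = ∑ i ∈ Finset.range (p.natDegree + 1),
        ‖p.coeff i‖ * (|t| ^ (k + i) * Real.exp (-(t ^ 2 / 2))) := by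
        rw [Finset.mul_sum, Finset.sum_mul]
        exact Finset.sum_congr rfl fun i _ => by ring
    _ ≤ _ := by
        gcongr with i
        exact pow_mul_exp_neg_sq_le _ _

open Polynomial in
/-- `polyGaussFun` as a Schwartz function. -/
noncomputable def polyGauss (p : ℂ[X]) : 𝓢(ℝ, ℂ) where
  toFun := polyGaussFun p
  smooth' := contDiff_polyGaussFun p
  decay' k n := by
    obtain ⟨q, hq⟩ := exists_iteratedDeriv_polyGaussFun p n
    obtain ⟨C, hC⟩ := exists_bound_polyGaussFun q k
    refine ⟨C, fun t => ?_⟩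
    rw [norm_iteratedFDeriv_eq_norm_iteratedDeriv, hq]
    exact hC t

theorem polyGauss_apply (p : Polynomial ℂ) (t : ℝ) : polyGauss p t = polyGaussFun p t := rfl

/-- The class in `L²(ℝ)` of `p(t) exp (-t² / 2)`. -/
noncomputable def polyGaussL2 (p : Polynomial ℂ) : L2R := (polyGauss p).toLp 2

theorem coeFn_polyGaussL2 (p : Polynomial ℂ) : polyGaussL2 p =ᵐ[volume] polyGaussFun p :=
  (polyGauss p).coeFn_toLp 2

theorem polyGauss_add (p q : Polynomial ℂ) : polyGauss (p + q) = polyGauss p + polyGauss q := by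
  ext t
  simp [polyGauss_apply, polyGaussFun, add_mul]

theorem polyGauss_smul (c : ℂ) (p : Polynomial ℂ) : polyGauss (c • p) = c • polyGauss p := by
  ext t
  simp [polyGauss_apply, polyGaussFun, mul_assoc]

theorem polyGauss_injective : Function.Injective polyGauss := by
  intro p q h
  refine Polynomial.eq_of_infinite_eval_eq p q ?_
  refine Set.Infinite.mono ?_ (Set.infinite_range_of_injective Complex.ofReal_injective)
  rintro _ ⟨t, rfl⟩
  have := congrArg (fun f : 𝓢(ℝ, ℂ) => f t) h
  simpa [polyGauss_apply, polyGaussFun, (Real.exp_pos _).ne'] using this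

/-- `polyGaussL2` as a linear map. -/
noncomputable def polyGaussLin : Polynomial ℂ →ₗ[ℂ] L2R where
  toFun := polyGaussL2
  map_add' p q := by
    rw [polyGaussL2, polyGauss_add]
    exact (SchwartzMap.toLpCLM ℂ ℂ 2 volume).map_add _ _
  map_smul' c p := by
    rw [polyGaussL2, polyGauss_smul]
    exact (SchwartzMap.toLpCLM ℂ ℂ 2 volume).map_smul _ _

theorem polyGaussLin_injective : Function.Injective polyGaussLin := fun _ _ h =>
  polyGauss_injective (SchwartzMap.injective_toLp 2 volume h)

/-! ### Clifford multiplication -/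

/-- The transpose of Clifford multiplication on test functions. -/
noncomputable def cliffordTest (x : Fin 2 → ℝ) (ψ : 𝓢(ℝ, ℂ)) : 𝓢(ℝ, ℂ) :=
  (x 0 * Complex.I) • SchwartzMap.smulLeftCLM ℂ (fun t : ℝ => (t : ℂ)) ψ -
    (x 1 : ℂ) • SchwartzMap.derivCLM ℂ ℂ ψ

theorem cliffordTest_apply (x : Fin 2 → ℝ) (ψ : 𝓢(ℝ, ℂ)) (t : ℝ) :
    cliffordTest x ψ t = x 0 * Complex.I * t * ψ t - x 1 * deriv ψ t := by
  have h : Function.HasTemperateGrowth (fun t : ℝ => (t : ℂ)) := by fun_prop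
  simp [cliffordTest, SchwartzMap.smulLeftCLM_apply_apply h, mul_assoc]

theorem integrable_L2R_mul (f : L2R) (ψ : 𝓢(ℝ, ℂ)) : Integrable (fun t => f t * ψ t) :=
  (Lp.memLp f).integrable_mul (ψ.memLp 2)

theorem isClifford_iff (x : Fin 2 → ℝ) (f h : L2R) :
    IsClifford x f h ↔ ∀ ψ : 𝓢(ℝ, ℂ), ∫ t, h t * ψ t = ∫ t, f t * cliffordTest x ψ t := by
  simp only [IsClifford, cliffordTest_apply]

theorem integral_add_mul_schwartz (f g : L2R) (ψ : 𝓢(ℝ, ℂ)) :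
    ∫ t, (f + g : L2R) t * ψ t = (∫ t, f t * ψ t) + ∫ t, g t * ψ t := by
  rw [← integral_add (integrable_L2R_mul f ψ) (integrable_L2R_mul g ψ)]
  refine integral_congr_ae ?_
  filter_upwards [Lp.coeFn_add f g] with t ht
  rw [ht, Pi.add_apply, add_mul]

theorem integral_smul_mul_schwartz (c : ℂ) (f : L2R) (ψ : 𝓢(ℝ, ℂ)) :
    ∫ t, (c • f : L2R) t * ψ t = c * ∫ t, f t * ψ t := by
  rw [← integral_const_mul]
  refine integral_congr_ae ?_
  filter_upwards [Lp.coeFn_smul c f] with t ht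
  rw [ht, Pi.smul_apply, smul_eq_mul, mul_assoc]

theorem IsClifford.add {x : Fin 2 → ℝ} {f f' h h' : L2R} (H : IsClifford x f h)
    (H' : IsClifford x f' h') : IsClifford x (f + f') (h + h') := by
  rw [isClifford_iff] at *
  intro ψ
  rw [integral_add_mul_schwartz, integral_add_mul_schwartz, H, H']

theorem IsClifford.smul {x : Fin 2 → ℝ} {f h : L2R} (H : IsClifford x f h) (c : ℂ) :
    IsClifford x (c • f) (c • h) := by
  rw [isClifford_iff] at *
  intro ψ
  rw [integral_smul_mul_schwartz, integral_smul_mul_schwartz, H]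

theorem IsClifford.zero (x : Fin 2 → ℝ) : IsClifford x 0 0 := by
  rw [isClifford_iff]
  intro ψ
  have h (φ : 𝓢(ℝ, ℂ)) : ∫ t, (0 : L2R) t * φ t = 0 := by
    have := integral_smul_mul_schwartz 0 0 φ
    rwa [zero_smul, zero_mul] at this
  rw [h, h]

theorem IsClifford.sum {ι : Type*} {x : Fin 2 → ℝ} {f h : ι → L2R} (s : Finset ι)
    (H : ∀ i ∈ s, IsClifford x (f i) (h i)) : IsClifford x (∑ i ∈ s, f i) (∑ i ∈ s, h i) := by
  classical
  induction s using Finset.induction_on with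
  | empty => simpa using IsClifford.zero x
  | insert a s ha ih =>
    rw [Finset.sum_insert ha, Finset.sum_insert ha]
    exact (H a (by simp)).add (ih fun i hi => H i (by simp [hi]))

/-- The fundamental lemma of the calculus of variations. Testing only against compact support leaves
room for multiplication by exp(t²/2) in `eq_smul_gauss_of_annihilated`. -/
theorem ext_of_integral_mul_schwartz {f g : L2R}
    (h : ∀ ψ : 𝓢(ℝ, ℂ), HasCompactSupport ψ → ∫ t, f t * ψ t = ∫ t, g t * ψ t) : f = g := by
  have hl (f : L2R) : LocallyIntegrable f := (Lp.memLp f).locallyIntegrable one_le_two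
  refine Lp.ext (ae_eq_of_integral_contDiff_smul_eq (hl f) (hl g) fun χ hχ hc => ?_)
  have hc' : HasCompactSupport (fun t => (χ t : ℂ)) := hc.comp_left Complex.ofReal_zero
  have hχ' : ContDiff ℝ ∞ (fun t => (χ t : ℂ)) := Complex.ofRealCLM.contDiff.comp hχ
  have e (f : L2R) : ∫ t, χ t • f t = ∫ t, f t * hc'.toSchwartzMap hχ' t :=
    integral_congr_ae (.of_forall fun t => by
      simp only [HasCompactSupport.toSchwartzMap_toFun, Complex.real_smul]
      exact mul_comm _ _)
  rw [e, e]
  exact h _ hc'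

theorem IsClifford.unique {x : Fin 2 → ℝ} {f h h' : L2R} (H : IsClifford x f h)
    (H' : IsClifford x f h') : h = h' :=
  ext_of_integral_mul_schwartz fun ψ _ => by rw [H ψ, H' ψ]

theorem integral_polyGaussL2_mul (p : Polynomial ℂ) (ψ : 𝓢(ℝ, ℂ)) :
    ∫ t, polyGaussL2 p t * ψ t = ∫ t, polyGauss p t * ψ t := by
  refine integral_congr_ae ?_
  filter_upwards [coeFn_polyGaussL2 p] with t ht
  rw [ht, polyGauss_apply]

open Polynomial in
theorem isClifford_polyGaussLin (x : Fin 2 → ℝ) (p : ℂ[X]) :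
    IsClifford x (polyGaussLin p)
      (polyGaussLin ((x 0 * Complex.I) • (X * p) + (x 1 : ℂ) • (derivative p - X * p))) := by
  intro ψ
  have hparts := SchwartzMap.integral_mul_deriv_eq_neg_deriv_mul (polyGauss p) ψ
  have hd : deriv (polyGauss p) = polyGauss (derivative p - X * p) := deriv_polyGaussFun p
  rw [hd] at hparts
  have h1 : ∀ t : ℝ, polyGauss (X * p) t = t * polyGauss p t := fun t => by
    simp [polyGauss_apply, polyGaussFun, mul_assoc]
  have e1 : ∫ t, polyGaussLin p t * (x 0 * Complex.I * t * ψ t - x 1 * deriv ψ t) =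
      ∫ t, polyGauss p t * cliffordTest x ψ t := by
    rw [← integral_polyGaussL2_mul]
    simp only [cliffordTest_apply]
    rfl
  rw [e1]
  have e2 := integral_polyGaussL2_mul
    ((x 0 * Complex.I) • (X * p) + (x 1 : ℂ) • (derivative p - X * p)) ψ
  refine e2.trans ?_
  have i1 : Integrable (fun t => polyGauss (X * p) t * ψ t) :=
    ((polyGauss (X * p)).memLp 2).integrable_mul (ψ.memLp 2)
  have i2 : Integrable (fun t => polyGauss (derivative p - X * p) t * ψ t) :=
    ((polyGauss (derivative p - X * p)).memLp 2).integrable_mul (ψ.memLp 2)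
  have i3 : Integrable (fun t => polyGauss p t * deriv ψ t) :=
    ((polyGauss p).memLp 2).integrable_mul ((SchwartzMap.derivCLM ℂ ℂ ψ).memLp 2)
  rw [polyGauss_add, polyGauss_smul, polyGauss_smul]
  calc _ = ∫ t, ((x 0 * Complex.I) * (polyGauss (X * p) t * ψ t) +
        x 1 * (polyGauss (derivative p - X * p) t * ψ t)) := by
        congr 1 with t
        simp
        ring
    _ = (x 0 * Complex.I) * (∫ t, polyGauss (X * p) t * ψ t) -
        x 1 * ∫ t, polyGauss p t * deriv ψ t := by
        rw [integral_add (i1.const_mul _) (i2.const_mul _), integral_const_mul,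
          integral_const_mul, hparts]
        ring
    _ = ∫ t, ((x 0 * Complex.I) * (polyGauss (X * p) t * ψ t) -
        x 1 * (polyGauss p t * deriv ψ t)) := by
        rw [integral_sub (i1.const_mul _) (i3.const_mul _), integral_const_mul, integral_const_mul]
    _ = _ := by
        congr 1 with t
        rw [cliffordTest_apply, h1]
        ring

/-! ### The kernel of the annihilation operator t + d/dt -/

/-- A smooth compactly supported function with integral zero has a compactly supported
primitive. -/
theorem exists_compactSupport_primitive {w : ℝ → ℂ} (hw : ContDiff ℝ ∞ w)
    (hc : HasCompactSupport w) (hi : ∫ t, w t = 0) :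
    ∃ W : ℝ → ℂ, ContDiff ℝ ∞ W ∧ HasCompactSupport W ∧ ∀ t, HasDerivAt W (w t) t := by
  obtain ⟨R, hR⟩ := hc.isCompact.isBounded.subset_closedBall (0 : ℝ)
  have hz : ∀ t, R < |t| → w t = 0 := fun t ht => by
    by_contra h
    have := hR (subset_tsupport w h)
    rw [mem_closedBall_zero_iff, Real.norm_eq_abs] at this
    linarith
  -- The absolute value is needed because R may be negative when the support is empty. To the left
  -- of a the integrand vanishes; to the right of -a the integral is already the total one, namely
  -- zero.
  set a := -(|R| + 1) with ha
  have hRa := le_abs_self R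
  have hd : ∀ t, HasDerivAt (fun t => ∫ s in a..t, w s) (w t) t := fun t =>
    intervalIntegral.integral_hasDerivAt_right (hw.continuous.intervalIntegrable _ _)
      (hw.continuous.stronglyMeasurableAtFilter _ _) hw.continuous.continuousAt
  refine ⟨fun t => ∫ s in a..t, w s, ?_, ?_, hd⟩
  · refine contDiff_infty_iff_deriv.2 ⟨fun t => (hd t).differentiableAt, ?_⟩
    rw [funext fun t => (hd t).deriv]
    exact hw
  · refine HasCompactSupport.of_support_subset_isCompact (isCompact_Icc (a := a) (b := -a)) ?_
    intro t ht
    by_contra hmem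
    refine ht ?_
    rw [Set.mem_Icc, not_and_or, not_le, not_le] at hmem
    rcases hmem with h | h
    · refine (intervalIntegral.integral_congr fun s hs => ?_).trans
        (intervalIntegral.integral_zero (a := a) (b := t))
      rw [Set.uIcc_of_ge h.le] at hs
      exact hz s (by rw [abs_of_nonpos] <;> linarith [hs.2, abs_nonneg R])
    · change ∫ s in a..t, w s = 0
      rw [intervalIntegral.integral_eq_integral_of_support_subset, hi]
      intro s hs
      have : |s| ≤ R := not_lt.1 fun h => hs (hz s h)
      rw [abs_le] at this
      exact ⟨by linarith, by linarith⟩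

theorem polyGaussFun_one (t : ℝ) : polyGaussFun 1 t = (Real.exp (-(t ^ 2 / 2)) : ℝ) := by
  simp [polyGaussFun]

/-- The square integrable distributional solutions of `f' + t f = 0` are the multiples of
`exp (-t² / 2)`. -/
theorem eq_smul_gauss_of_annihilated {f : L2R}
    (hf : ∀ ψ : 𝓢(ℝ, ℂ), ∫ t, f t * (t * ψ t - deriv ψ t) = 0) :
    ∃ c : ℂ, f = c • polyGaussLin 1 := by
  have hg : ContDiff ℝ ∞ (polyGaussFun 1) := contDiff_polyGaussFun 1
  set e : ℝ → ℂ := fun t => (Real.exp (t ^ 2 / 2) : ℝ) with he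
  have hed : ∀ t, HasDerivAt e (t * e t) t := fun t => by
    have h : HasDerivAt (fun t : ℝ => t ^ 2 / 2) t t :=
      ((hasDerivAt_pow 2 t).div_const 2).congr_deriv (by simp)
    refine h.exp.ofReal_comp.congr_deriv ?_
    simp only [he]
    push_cast
    ring
  have hesm : ContDiff ℝ ∞ e := Complex.ofRealCLM.contDiff.comp
    (Real.contDiff_exp.comp ((contDiff_id.pow 2).div_const 2))
  have heg : ∀ t, e t * polyGaussFun 1 t = 1 := fun t => by
    rw [polyGaussFun_one, he, ← Complex.ofReal_mul, ← Real.exp_add]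
    simp
  have key : ∀ w : ℝ → ℂ, ContDiff ℝ ∞ w → HasCompactSupport w →
      ∫ t, w t * polyGaussFun 1 t = 0 → ∫ t, f t * w t = 0 := by
    intro w hw hc hi
    -- With W' = w exp(-t²/2), the test function χ = -exp(t²/2) W solves tχ - χ' = w.
    obtain ⟨W, hWs, hWc, hWd⟩ := exists_compactSupport_primitive (hw.mul hg) hc.mul_right hi
    have hχc : HasCompactSupport (fun t => -(e t * W t)) := by
      exact (hWc.mul_left (f := e)).neg
    have hχs : ContDiff ℝ ∞ (fun t => -(e t * W t)) := (hesm.mul hWs).neg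
    rw [← hf (hχc.toSchwartzMap hχs)]
    congr 1 with t
    have hd : HasDerivAt (fun t => -(e t * W t))
        (-(t * e t * W t + e t * (w t * polyGaussFun 1 t))) t := ((hed t).mul (hWd t)).neg
    have hd' : deriv (hχc.toSchwartzMap hχs) t =
        -(t * e t * W t + e t * (w t * polyGaussFun 1 t)) := hd.deriv
    rw [hd', HasCompactSupport.toSchwartzMap_toFun]
    linear_combination (-f t * w t) * heg t
  obtain ⟨ρ, hρs, hρc, hρ⟩ : ∃ ρ : ℝ → ℂ, ContDiff ℝ ∞ ρ ∧ HasCompactSupport ρ ∧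
      ∫ t, ρ t * polyGaussFun 1 t = 1 := by
    let b : ContDiffBump (0 : ℝ) := default
    have hsm : ContDiff ℝ ∞ (fun t => (b t : ℂ)) := Complex.ofRealCLM.contDiff.comp b.contDiff
    have hcs : HasCompactSupport (fun t => (b t : ℂ)) :=
      b.hasCompactSupport.comp_left Complex.ofReal_zero
    have hint : ∫ t, (b t : ℂ) * polyGaussFun 1 t =
        ((∫ t, b t * Real.exp (-(t ^ 2 / 2)) : ℝ) : ℂ) := by
      rw [← integral_complex_ofReal]
      congr 1 with t
      rw [polyGaussFun_one, Complex.ofReal_mul]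
    have hpos : 0 < ∫ t, b t * Real.exp (-(t ^ 2 / 2)) := by
      have hcont : Continuous fun t : ℝ => b t * Real.exp (-(t ^ 2 / 2)) :=
        b.continuous.mul (by fun_prop)
      refine hcont.integral_pos_of_hasCompactSupport_nonneg_nonzero
        (b.hasCompactSupport.mul_right) (fun t => mul_nonneg b.nonneg (Real.exp_pos _).le)
        (x := 0) ?_
      rw [b.one_of_mem_closedBall (Metric.mem_closedBall_self b.rIn_pos.le)]
      simp
    refine ⟨fun t => ((∫ t, b t * Real.exp (-(t ^ 2 / 2)) : ℝ) : ℂ)⁻¹ * (b t : ℂ),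
      contDiff_const.mul hsm, hcs.mul_left, ?_⟩
    simp_rw [mul_assoc]
    rw [integral_const_mul, hint, inv_mul_cancel₀]
    exact_mod_cast hpos.ne'
  refine ⟨∫ t, f t * ρ t, ext_of_integral_mul_schwartz fun ψ hψ => ?_⟩
  have hint : ∫ t, ((∫ t, f t * ρ t) • polyGaussLin 1 : L2R) t * ψ t =
      (∫ t, f t * ρ t) * ∫ t, ψ t * polyGaussFun 1 t := by
    rw [integral_smul_mul_schwartz]
    congr 1
    refine (integral_polyGaussL2_mul 1 ψ).trans ?_
    congr 1 with t
    rw [polyGauss_apply, mul_comm]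
  rw [hint]
  set c := ∫ t, ψ t * polyGaussFun 1 t with hcdef
  have hψs : ContDiff ℝ ∞ ψ := ψ.smooth ⊤
  have iρ : Integrable fun t => ρ t * polyGaussFun 1 t :=
    (hρs.mul hg).continuous.integrable_of_hasCompactSupport hρc.mul_right
  have iψ : Integrable fun t => ψ t * polyGaussFun 1 t :=
    (hψs.mul hg).continuous.integrable_of_hasCompactSupport hψ.mul_right
  -- Subtracting c ρ makes the pairing with the Gaussian vanish, so f is determined by its pairing
  -- with ρ alone.
  have h0 := key (fun t => ψ t - c * ρ t) (hψs.sub (contDiff_const.mul hρs))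
    (hψ.sub (hρc.mul_left)) (by
      simp_rw [sub_mul, mul_assoc]
      rw [integral_sub iψ (iρ.const_mul c), integral_const_mul, hρ, mul_one, sub_self])
  have ifψ := integrable_L2R_mul f ψ
  have ifρ : Integrable fun t => f t * ρ t := integrable_L2R_mul f (hρc.toSchwartzMap hρs)
  have h1 : ∫ t, f t * (ψ t - c * ρ t) = (∫ t, f t * ψ t) - c * ∫ t, f t * ρ t := by
    rw [← integral_const_mul, ← integral_sub ifψ (ifρ.const_mul c)]
    congr 1 with t
    ring
  rw [h1, sub_eq_zero] at h0
  rw [h0, mul_comm]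

/-! ### The characters of the circle -/

/-- By Parseval, a function of modulus one has a nonzero Fourier coefficient, say the n-th. Then g =
e_{-n} c is multiplicative with nonzero integral, and translation invariance gives (∫ g) g(y) = ∫ g,
so g = 1. -/
theorem exists_eq_zpow_of_character (c : Circle → ℂ) (hc : Continuous c)
    (hmul : ∀ u v, c (u * v) = c u * c v) (hnorm : ∀ u, ‖c u‖ = 1) :
    ∃ m : ℤ, ∀ u, c u = (u : ℂ) ^ m := by
  have : Fact (0 < 2 * Real.pi) := ⟨Real.two_pi_pos⟩
  let f : C(AddCircle (2 * Real.pi), ℂ) :=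
    ⟨fun x => c x.toCircle, hc.comp AddCircle.continuous_toCircle⟩
  have hadd : ∀ x y, f (x + y) = f x * f y := fun x y => by
    simp [f, AddCircle.toCircle_add, hmul]
  obtain ⟨n, hn⟩ : ∃ n, fourierCoeff f n ≠ 0 := by
    by_contra! h
    have h1 := tsum_sq_fourierCoeff (ContinuousMap.toLp 2 AddCircle.haarAddCircle ℂ f)
    simp only [fourierCoeff_toLp, h, norm_zero] at h1
    have h2 : ∫ t, ‖(ContinuousMap.toLp 2 AddCircle.haarAddCircle ℂ f) t‖ ^ 2
        ∂AddCircle.haarAddCircle = ∫ t : AddCircle (2 * Real.pi), (1 : ℝ)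
        ∂AddCircle.haarAddCircle := by
      refine integral_congr_ae ?_
      filter_upwards [ContinuousMap.coeFn_toLp (p := 2) (𝕜 := ℂ) AddCircle.haarAddCircle f] with t ht
      rw [ht]
      simp [f, hnorm]
    rw [h2] at h1
    simp at h1
  refine ⟨n, fun u => ?_⟩
  set g : AddCircle (2 * Real.pi) → ℂ := fun x => fourier (-n) x • f x with hg
  have hgadd : ∀ x y, g (x + y) = g x * g y := fun x y => by
    have : fourier (-n) (x + y) = fourier (-n) x * fourier (-n) y := by
      simp [fourier_apply, AddCircle.toCircle_add, smul_add]
    simp only [hg, this, hadd, smul_eq_mul]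
    ring
  have hg1 : ∀ y, g y = 1 := fun y => by
    have h1 : ∫ x, g (x + y) ∂AddCircle.haarAddCircle = ∫ x, g x ∂AddCircle.haarAddCircle :=
      integral_add_right_eq_self g y
    simp_rw [hgadd] at h1
    rw [integral_mul_const] at h1
    exact mul_left_cancel₀ hn (h1.trans (mul_one _).symm)
  obtain ⟨y, rfl⟩ : ∃ y : AddCircle (2 * Real.pi), y.toCircle = u :=
    by
    obtain ⟨y, rfl⟩ := (AddCircle.homeomorphCircle Real.two_pi_pos.ne').surjective u
    exact ⟨y, (AddCircle.homeomorphCircle_apply _ y).symm⟩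
  have h1 := hg1 y
  have h2 : fourier n y * fourier (-n) y = 1 := by
    rw [← fourier_add]
    simp
  have h3 : fourier n y = (y.toCircle : ℂ) ^ n := by
    rw [fourier_apply, AddCircle.toCircle_zsmul, Circle.coe_zpow]
  rw [← h3]
  change f y = _
  simp only [hg, smul_eq_mul] at h1
  linear_combination (-f y) * h2 + fourier n y * h1

/-! ### Hermite functions and the action of the isotropy group -/

open Polynomial in
/-- The (physicists') Hermite polynomials. -/
noncomputable def hermitePoly : ℕ → ℂ[X]
  | 0 => 1
  | k + 1 => (2 : ℂ) • (X * hermitePoly k) - derivative (hermitePoly k)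

open Polynomial in
theorem hermitePoly_succ (k : ℕ) :
    hermitePoly (k + 1) = (2 : ℂ) • (X * hermitePoly k) - derivative (hermitePoly k) := rfl

open Polynomial in
theorem derivative_hermitePoly (k : ℕ) :
    derivative (hermitePoly k) = (2 * k : ℂ) • hermitePoly (k - 1) := by
  induction k with
  | zero => simp [hermitePoly]
  | succ k ih =>
    rcases k with _ | k
    · simp [hermitePoly]
    · have h : derivative (hermitePoly k) = (2 : ℂ) • (X * hermitePoly k) - hermitePoly (k + 1) := by
        rw [hermitePoly_succ k, sub_sub_cancel]
      simp only [Nat.add_sub_cancel] at ih ⊢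
      rw [hermitePoly_succ (k + 1), derivative_sub, derivative_smul, derivative_mul, derivative_X,
        one_mul, ih, derivative_smul, h, mul_smul_comm]
      push_cast
      module

open Polynomial in
theorem degree_hermitePoly (k : ℕ) : (hermitePoly k).degree = k := by
  induction k with
  | zero => simp [hermitePoly]
  | succ k ih =>
    have h1 : ((2 : ℂ) • (X * hermitePoly k)).degree = ((k + 1 : ℕ) : WithBot ℕ) := by
      rw [smul_eq_C_mul, degree_C_mul two_ne_zero, degree_mul, degree_X, ih]
      push_cast
      exact add_comm _ _
    have h0 : hermitePoly k ≠ 0 := fun h => by simp [h] at ih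
    have h2 : (derivative (hermitePoly k)).degree < ((2 : ℂ) • (X * hermitePoly k)).degree := by
      refine (degree_derivative_lt h0).trans ?_
      rw [h1, ih]
      exact_mod_cast Nat.lt_succ_self k
    rw [hermitePoly_succ, degree_sub_eq_left_of_degree_lt h2, h1]

theorem linearIndependent_hermitePoly : LinearIndependent ℂ hermitePoly :=
  Polynomial.Sequence.linearIndependent ⟨hermitePoly, degree_hermitePoly⟩

/-- The (unnormalised) Hermite functions in `L²(ℝ)`. -/
noncomputable def hermiteFun (k : ℕ) : L2R := polyGaussLin (hermitePoly k)

theorem linearIndependent_hermiteFun : LinearIndependent ℂ hermiteFun :=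
  linearIndependent_hermitePoly.map' polyGaussLin (LinearMap.ker_eq_bot.2 polyGaussLin_injective)

-- The two recursions give X H_k = H_{k+1}/2 + k H_{k-1}. At k = 0 the truncated index `k - 1` is
-- harmless, as its coefficient vanishes.
open Polynomial in
theorem isClifford_hermiteFun (x : Fin 2 → ℝ) (k : ℕ) :
    IsClifford x (hermiteFun k) (((x 0 * Complex.I - x 1) / 2) • hermiteFun (k + 1) +
      ((x 0 * Complex.I + x 1) * k) • hermiteFun (k - 1)) := by
  have h := isClifford_polyGaussLin x (hermitePoly k)
  have e : (x 0 * Complex.I : ℂ) • (X * hermitePoly k) +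
      (x 1 : ℂ) • (derivative (hermitePoly k) - X * hermitePoly k) =
      ((x 0 * Complex.I - x 1) / 2 : ℂ) • hermitePoly (k + 1) +
        ((x 0 * Complex.I + x 1) * k : ℂ) • hermitePoly (k - 1) := by
    rw [hermitePoly_succ, derivative_hermitePoly]
    module
  rw [e, map_add, map_smul, map_smul] at h
  exact h

theorem isotropy_mulVec (u : Circle) (x : Fin 2 → ℝ) :
    (isotropy u : Matrix (Fin 2) (Fin 2) ℝ) *ᵥ x =
      ![((u : ℂ) ^ 2).re * x 0 - ((u : ℂ) ^ 2).im * x 1,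
        ((u : ℂ) ^ 2).im * x 0 + ((u : ℂ) ^ 2).re * x 1] := by
  ext i
  fin_cases i
  · simp [isotropy, Matrix.mulVec, dotProduct, Fin.sum_univ_two]
    ring
  · simp [isotropy, Matrix.mulVec, dotProduct, Fin.sum_univ_two]

/-- A rotation multiplies -iE₁ + E₂ by a scalar, so U preserves the kernel of t + d/dt, which is the
line of the Gaussian. -/
theorem exists_eigenvalue_hermiteFun_zero {U : L2R ≃ₗᵢ[ℂ] L2R} {u : Circle}
    (hU : Covers U (isotropy u)) : ∃ c : ℂ, U (hermiteFun 0) = c • hermiteFun 0 := by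
  have hn : ((u : ℂ) ^ 2).re * ((u : ℂ) ^ 2).re + ((u : ℂ) ^ 2).im * ((u : ℂ) ^ 2).im = 1 := by
    rw [← Complex.normSq_apply, Complex.normSq_eq_norm_sq, norm_pow, Circle.norm_coe]
    norm_num
  set a := ((u : ℂ) ^ 2).re with ha
  set b := ((u : ℂ) ^ 2).im with hb
  -- The vectors (a, -b) and (b, a) are the preimages of E₁ and E₂ under the rotation.
  have h1 := (hU ![a, -b] _ _).1 (isClifford_hermiteFun ![a, -b] 0)
  have h2 := (hU ![b, a] _ _).1 (isClifford_hermiteFun ![b, a] 0)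
  rw [isotropy_mulVec, ← ha, ← hb] at h1 h2
  refine eq_smul_gauss_of_annihilated fun ψ => ?_
  have i1 := h1 ψ
  have i2 := h2 ψ
  simp only [Matrix.cons_val_zero, Matrix.cons_val_one, Nat.cast_zero, mul_zero, zero_smul,
    add_zero, map_smul, integral_smul_mul_schwartz] at i1 i2
  have e1 : a * a - b * -b = 1 := by linarith
  have e2 : b * a + a * -b = 0 := by ring
  have e3 : a * b - b * a = 0 := by ring
  have e4 : b * b + a * a = 1 := by linarith
  rw [e1, e2] at i1
  rw [e3, e4] at i2
  simp only [Complex.ofReal_one, Complex.ofReal_zero, one_mul, zero_mul, sub_zero, zero_sub] at i1 i2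
  have j1 : Integrable fun t => (U (hermiteFun 0)) t * (Complex.I * t * ψ t) := by
    have := integrable_L2R_mul (U (hermiteFun 0)) (cliffordTest ![1, 0] ψ)
    simpa [cliffordTest_apply] using this
  have j2 : Integrable fun t => (U (hermiteFun 0)) t * -deriv ψ t := by
    have := integrable_L2R_mul (U (hermiteFun 0)) (cliffordTest ![0, 1] ψ)
    simpa [cliffordTest_apply] using this
  have key : ∫ t, (U (hermiteFun 0)) t * (t * ψ t - deriv ψ t) =
      (-Complex.I) * (∫ t, (U (hermiteFun 0)) t * (Complex.I * t * ψ t)) +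
        ∫ t, (U (hermiteFun 0)) t * -deriv ψ t := by
    rw [← integral_const_mul, ← integral_add (j1.const_mul _) j2]
    congr 1 with t
    linear_combination ((U (hermiteFun 0)) t * t * ψ t) * Complex.I_sq
  change ∫ t, (U (hermiteFun 0)) t * (t * ψ t - deriv ψ t) = 0
  rw [key, ← i1, ← i2]
  simp only [Complex.ofReal_neg]
  linear_combination (-(a / 2 * ∫ t, (U (hermiteFun (0 + 1))) t * ψ t)) * Complex.I_sq

/-- The raising operator -iE₁ - E₂ carries h_k to h_{k+1}, and the rotation κ(u) multiplies it by
u². -/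
theorem map_hermiteFun_succ {U : L2R ≃ₗᵢ[ℂ] L2R} {u : Circle} (hU : Covers U (isotropy u))
    {k : ℕ} {c : ℂ} (h : U (hermiteFun k) = c • hermiteFun k) :
    U (hermiteFun (k + 1)) = (c * (u : ℂ) ^ 2) • hermiteFun (k + 1) := by
  have hx (x : Fin 2 → ℝ) := by
    have h1 := (hU x _ _).1 (isClifford_hermiteFun x k)
    rw [h] at h1
    exact h1.unique ((isClifford_hermiteFun _ k).smul c)
  have h1 := hx ![1, 0]
  have h2 := hx ![0, 1]
  rw [isotropy_mulVec] at h1 h2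
  have hu : (u : ℂ) ^ 2 = (((u : ℂ) ^ 2).re : ℂ) + ((u : ℂ) ^ 2).im * Complex.I :=
    (Complex.re_add_im _).symm
  simp only [Matrix.cons_val_zero, Matrix.cons_val_one, map_add, map_smul, mul_one, mul_zero,
    sub_zero, zero_sub, add_zero, zero_add, Complex.ofReal_one, Complex.ofReal_zero, one_mul,
    zero_mul] at h1 h2
  rw [hu]
  set a := ((u : ℂ) ^ 2).re
  set b := ((u : ℂ) ^ 2).im
  have hI : Complex.I * Complex.I = -1 := Complex.I_mul_I
  -- In -iE₁ - E₂ the contributions of `hermiteFun (k - 1)` cancel.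
  have e : U (hermiteFun (k + 1)) = (-Complex.I) • ((Complex.I / 2) • U (hermiteFun (k + 1)) +
      (Complex.I * k) • U (hermiteFun (k - 1))) +
      (-1 : ℂ) • ((-1 / 2 : ℂ) • U (hermiteFun (k + 1)) + (k : ℂ) • U (hermiteFun (k - 1))) := by
    match_scalars
    · linear_combination (1 / 2 : ℂ) * hI
    · linear_combination (k : ℂ) * hI
  rw [e, h1, h2]
  match_scalars
  · linear_combination (-1 / 2 * c * a) * hI
  · linear_combination (-c * a * k) * hI

theorem hermiteFun_ne_zero (k : ℕ) : hermiteFun k ≠ 0 := linearIndependent_hermiteFun.ne_zero k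

/-- A lift of the isotropy representation acts on the Hermite functions by characters. -/
theorem MetaplecticLift.exists_weight (κt : MetaplecticLift) :
    ∃ m : ℤ, ∀ (u : Circle) (k : ℕ), (κt.hom u : L2R ≃ₗᵢ[ℂ] L2R) (hermiteFun k) =
      ((u : ℂ) ^ (m + 2 * k)) • hermiteFun k := by
  choose c hc using fun u => exists_eigenvalue_hermiteFun_zero (κt.covers u)
  have h0 := hermiteFun_ne_zero 0
  have hmul : ∀ u v, c (u * v) = c u * c v := fun u v => by
    refine smul_left_injective ℂ h0 ?_
    simp only
    rw [← hc, map_mul]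
    change (κt.hom u : L2R ≃ₗᵢ[ℂ] L2R) ((κt.hom v : L2R ≃ₗᵢ[ℂ] L2R) (hermiteFun 0)) = _
    rw [hc, map_smul, hc, smul_smul, mul_comm]
  have hnorm : ∀ u, ‖c u‖ = 1 := fun u => by
    have := congrArg norm (hc u)
    rw [LinearIsometryEquiv.norm_map, norm_smul] at this
    exact (mul_right_cancel₀ (norm_ne_zero_iff.2 h0) (by rw [one_mul]; exact this)).symm
  -- Strong continuity of the lift passes to c through the matrix coefficient ⟨h_0, λ(u) h_0⟩.
  have hcont : Continuous c := by
    have h1 : c = fun u => inner ℂ (hermiteFun 0) ((κt.hom u : L2R ≃ₗᵢ[ℂ] L2R) (hermiteFun 0)) /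
        inner ℂ (hermiteFun 0) (hermiteFun 0) := by
      funext u
      rw [hc, inner_smul_right, mul_div_cancel_right₀]
      exact inner_self_ne_zero.2 h0
    rw [h1]
    exact (continuous_const.inner (κt.continuous_hom _)).div_const _
  obtain ⟨m, hm⟩ := exists_eq_zpow_of_character c hcont hmul hnorm
  refine ⟨m, fun u k => ?_⟩
  induction k with
  | zero => rw [hc, hm]; simp
  | succ k ih =>
    rw [map_hermiteFun_succ (κt.covers u) ih]
    congr 1
    rw [← zpow_natCast (u : ℂ) 2, ← zpow_add₀ u.coe_ne_zero]
    congr 1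
    push_cast
    ring

/-! ### Jacobi matrices and three-term recurrences -/

/-- The symmetric tridiagonal matrix with zero diagonal and off-diagonal entries `b k`. -/
def jacobiMatrix (b : ℕ → ℝ) (n : ℕ) : Matrix (Fin n) (Fin n) ℝ :=
  Matrix.of fun i j => if (j : ℕ) = i + 1 then b i else if (i : ℕ) = j + 1 then b j else 0

theorem isHermitian_jacobiMatrix (b : ℕ → ℝ) (n : ℕ) : (jacobiMatrix b n).IsHermitian := by
  ext i j
  simp only [jacobiMatrix, Matrix.conjTranspose_apply, Matrix.of_apply, star_trivial]
  split_ifs <;> first | rfl | omega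

/-- Extending vectors by zero to all of ℕ spares the last row a separate case. -/
theorem jacobiMatrix_mulVec (b : ℕ → ℝ) (n : ℕ) (w : ℕ → ℝ) (hw : ∀ k, n ≤ k → w k = 0)
    (i : Fin n) : (jacobiMatrix b n *ᵥ fun j => w j) i =
      b i * w (i + 1) + if (i : ℕ) = 0 then 0 else b (i - 1) * w (i - 1) := by
  obtain ⟨i, hi⟩ := i
  have h1 : ∑ j : Fin n, (if (j : ℕ) = i + 1 then b i * w j else 0) = b i * w (i + 1) := by
    rw [Fin.sum_univ_eq_sum_range (fun j => if j = i + 1 then b i * w j else 0) n,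
      Finset.sum_ite_eq']
    split_ifs with h
    · rfl
    · rw [hw (i + 1) (by simpa using h), mul_zero]
  have h2 : ∑ j : Fin n, (if i = (j : ℕ) + 1 then b j * w j else 0) =
      if i = 0 then 0 else b (i - 1) * w (i - 1) := by
    rw [Fin.sum_univ_eq_sum_range (fun j => if i = j + 1 then b j * w j else 0) n]
    rcases i with _ | i
    · simp
    · simp only [Nat.add_right_cancel_iff, Finset.sum_ite_eq, Finset.mem_range]
      rw [if_pos (by omega)]
      simp
  simp only [Matrix.mulVec, dotProduct, jacobiMatrix, Matrix.of_apply]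
  rw [← h1, ← h2, ← Finset.sum_add_distrib]
  refine Finset.sum_congr rfl fun j _ => ?_
  split_ifs <;> first | omega | simp

/-- The largest eigenvalue of a Jacobi matrix is at least its first off-diagonal entry. -/
theorem exists_eigenvalue_jacobiMatrix (b : ℕ → ℝ) (n : ℕ) :
    ∃ r : ℝ, b 0 ≤ r ∧ ∃ w : ℕ → ℝ, (∃ k, w k ≠ 0) ∧ (∀ k, n + 2 ≤ k → w k = 0) ∧
      ∀ k < n + 2, r * w k = b k * w (k + 1) + if k = 0 then 0 else b (k - 1) * w (k - 1) := by
  set S := jacobiMatrix b (n + 2)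
  set T := Matrix.toEuclideanLin S with hTdef
  have hT : T.IsSymmetric := Matrix.isSymmetric_toEuclideanLin_iff.2 (isHermitian_jacobiMatrix b _)
  -- The supremum of the Rayleigh quotient is an eigenvalue of a symmetric operator.
  set r : ℝ := ⨆ x : { x : EuclideanSpace ℝ (Fin (n + 2)) // x ≠ 0 },
    RCLike.re (inner ℝ (T x) x) / ‖(x : EuclideanSpace ℝ (Fin (n + 2)))‖ ^ 2 with hr
  have hev : Module.End.HasEigenvalue T r := hT.hasEigenvalue_iSup_of_finiteDimensional
  have hbdd : BddAbove (Set.range fun x : { x : EuclideanSpace ℝ (Fin (n + 2)) // x ≠ 0 } =>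
      RCLike.re (inner ℝ (T x) x) / ‖(x : EuclideanSpace ℝ (Fin (n + 2)))‖ ^ 2) := by
    refine ⟨‖T.toContinuousLinearMap‖, ?_⟩
    rintro _ ⟨⟨x, hx⟩, rfl⟩
    have hx' : 0 < ‖x‖ := norm_pos_iff.2 hx
    rw [div_le_iff₀ (by positivity)]
    have h1 : inner ℝ (T x) x ≤ ‖T x‖ * ‖x‖ := real_inner_le_norm _ _
    have h2 : ‖T x‖ ≤ ‖T.toContinuousLinearMap‖ * ‖x‖ := T.toContinuousLinearMap.le_opNorm x
    simp only [RCLike.re_to_real]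
    nlinarith
  have hT_apply (w : ℕ → ℝ) (hw : ∀ k, n + 2 ≤ k → w k = 0) (i : Fin (n + 2)) :
      T (WithLp.toLp 2 fun j => w j) i =
        b i * w (i + 1) + if (i : ℕ) = 0 then 0 else b (i - 1) * w (i - 1) := by
    rw [← jacobiMatrix_mulVec b (n + 2) w hw i]
    rfl
  refine ⟨r, ?_, ?_⟩
  -- The test vector (1, 1, 0, …, 0) has Rayleigh quotient 2 b₀ / 2 = b₀.
  · set y : EuclideanSpace ℝ (Fin (n + 2)) :=
      WithLp.toLp 2 fun j => if (j : ℕ) ≤ 1 then 1 else 0 with hy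
    have hy0 : y 0 = 1 := by simp [hy]
    have hyne : y ≠ 0 := fun h => by simp [h] at hy0
    have hle := le_ciSup hbdd ⟨y, hyne⟩
    refine le_trans (le_of_eq ?_) hle
    have hTy := hT_apply (fun j => if j ≤ 1 then 1 else 0) (fun k hk => by simp; omega)
    have hn : ‖y‖ ^ 2 = 2 := by
      rw [EuclideanSpace.norm_sq_eq, Fin.sum_univ_succ, Fin.sum_univ_succ]
      simp [hy]
      norm_num
    have hi : inner ℝ (T y) y = 2 * b 0 := by
      rw [PiLp.inner_apply, Fin.sum_univ_succ, Fin.sum_univ_succ]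
      simp only [hy, hTy]
      simp
      ring
    simp only [hi, hn, RCLike.re_to_real]
    ring
  · obtain ⟨x, hx⟩ := hev.exists_hasEigenvector
    set w : ℕ → ℝ := fun k => if h : k < n + 2 then x ⟨k, h⟩ else 0 with hw
    have hwx : ∀ j : Fin (n + 2), w j = x j := fun j => by simp [hw]
    have hxw : x = WithLp.toLp 2 fun j : Fin (n + 2) => w j := by
      ext j
      simp [hwx]
    have hw0 : ∀ k, n + 2 ≤ k → w k = 0 := fun k hk => by simp [hw, not_lt.2 hk]
    refine ⟨w, ?_, hw0, fun k hk => ?_⟩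
    · by_contra! h
      exact hx.2 (by ext j; simp [hxw, h])
    · have h1 := congrArg (fun z : EuclideanSpace ℝ (Fin (n + 2)) => z ⟨k, hk⟩) hx.apply_eq_smul
      have h2 := hT_apply w hw0 ⟨k, hk⟩
      rw [← hxw] at h2
      simp only at h1 h2
      rw [h2] at h1
      rw [h1]
      simp [← hwx]

/-- A three-term recurrence with positive coefficients has solutions with large eigenvalues. -/
theorem exists_eigenvalue_recurrence (β γ : ℕ → ℝ) (n : ℕ) (hβ : ∀ k ≤ n, 0 < β k)
    (hγ : ∀ k ≤ n, 0 < γ k) :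
    ∃ r : ℝ, √(β 0 * γ 0) ≤ r ∧ ∃ v : ℕ → ℝ, (∃ k, v k ≠ 0) ∧ (∀ k, n + 2 ≤ k → v k = 0) ∧
      ∀ k < n + 2, r * v k = β k * v (k + 1) + if k = 0 then 0 else γ (k - 1) * v (k - 1) := by
  obtain ⟨r, hr, w, ⟨k₀, hk₀⟩, hw0, hw⟩ :=
    exists_eigenvalue_jacobiMatrix (fun k => √(β k * γ k)) n
  -- The diagonal rescaling v_k = d_k w_k with d_{k+1}/d_k = √(γ_k/β_k) makes both off-diagonal
  -- entries equal to √(β_k γ_k).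
  set d : ℕ → ℝ := fun k => ∏ j ∈ Finset.range k, √(γ j / β j) with hd
  have hdpos : ∀ k ≤ n + 1, d k ≠ 0 := fun k hk => by
    refine Finset.prod_ne_zero_iff.2 fun j hj => ?_
    have hj' : j ≤ n := by have := Finset.mem_range.1 hj; omega
    exact (Real.sqrt_pos.2 (div_pos (hγ j hj') (hβ j hj'))).ne'
  have h1 : ∀ k ≤ n, β k * d (k + 1) = d k * √(β k * γ k) := fun k hk => by
    have hb := hβ k hk
    have hc := hγ k hk
    simp only [hd, Finset.prod_range_succ]
    rw [Real.sqrt_div hc.le, Real.sqrt_mul hb.le]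
    have := Real.sq_sqrt hb.le
    have hs := (Real.sqrt_pos.2 hb).ne'
    field_simp
    rw [this, mul_comm]
  have h2 : ∀ k ≤ n, γ k * d k = d (k + 1) * √(β k * γ k) := fun k hk => by
    have hb := hβ k hk
    have hc := hγ k hk
    simp only [hd, Finset.prod_range_succ]
    rw [Real.sqrt_div hc.le, Real.sqrt_mul hb.le]
    have := Real.sq_sqrt hc.le
    have hs := (Real.sqrt_pos.2 hb).ne'
    field_simp
    rw [this, mul_comm]
  refine ⟨r, hr, fun k => d k * w k, ⟨k₀, mul_ne_zero (hdpos k₀ ?_) hk₀⟩,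
    fun k hk => by simp [hw0 k hk], fun k hk => ?_⟩
  · by_contra h
    exact hk₀ (hw0 k₀ (by omega))
  · have e1 : β k * (d (k + 1) * w (k + 1)) = d k * (√(β k * γ k) * w (k + 1)) := by
      -- For k = n + 1 nothing is known about the sign of β_k, but there w_{k+1} = 0.
      by_cases hkn : k ≤ n
      · rw [← mul_assoc, h1 k hkn, mul_assoc]
      · simp [hw0 (k + 1) (by omega)]
    rcases k with _ | k
    · have := hw 0 hk
      simp only [if_true, add_zero] at this ⊢
      rw [e1, ← this]
      ring
    · have := hw (k + 1) hk
      simp only [Nat.succ_ne_zero, if_false, Nat.add_sub_cancel] at this ⊢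
      rw [e1, ← mul_assoc (γ k), h2 k (by omega)]
      linear_combination d (k + 1) * this

/-! ### Calculus on `SU(2)` -/

open scoped Matrix.Norms.Operator in
theorem hasDerivAt_expM_apply (x : Fin 2 → ℝ) (i j : Fin 2) :
    HasDerivAt (fun t : ℝ => (expM (t • x)).1 i j) (mElem x i j) 0 := by
  have h1 : HasDerivAt (fun t : ℝ => NormedSpace.exp (t • mElem x)) (mElem x) 0 := by
    have := hasDerivAt_exp_smul_const (𝕂 := ℝ) (mElem x) (0 : ℝ)
    rw [zero_smul, NormedSpace.exp_zero, one_mul] at this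
    exact this
  have h2 : ∀ t : ℝ, mElem (t • x) = t • mElem x := fun t => by
    rw [mElem_eq, mElem_eq]
    ext i j
    fin_cases i <;> fin_cases j <;> simp <;> ring
  have h3 : (fun t : ℝ => (expM (t • x)).1 i j) = fun t => NormedSpace.exp (t • mElem x) i j := by
    funext t
    rw [← h2]
    rfl
  rw [h3]
  let L : Matrix (Fin 2) (Fin 2) ℂ →ₗ[ℝ] ℂ :=
    { toFun := fun A => A i j, map_add' := fun _ _ => rfl, map_smul' := fun _ _ => rfl }
  exact L.toContinuousLinearMap.hasFDerivAt.comp_hasDerivAt (0 : ℝ) h1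

theorem expM_zero : expM 0 = 1 := by
  refine Subtype.ext ?_
  have : mElem 0 = 0 := by
    rw [mElem_eq]
    ext i j
    fin_cases i <;> fin_cases j <;> simp
  simp [expM, this]

/-- The matrix coefficient `g₀₀ ^ p * g₀₁ ^ q` of `SU(2)`. -/
def rowMonomial (p q : ℕ) (g : SU2) : ℂ := g.1 0 0 ^ p * g.1 0 1 ^ q

theorem rowMonomial_mul_torus (p q : ℕ) (g : SU2) (u : Circle) :
    rowMonomial p q (g * torus u) = (u : ℂ) ^ ((p : ℤ) - q) * rowMonomial p q g := by
  have hu : star (u : ℂ) = (u : ℂ)⁻¹ := by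
    rw [← Circle.coe_inv, Circle.coe_inv_eq_conj]
    rfl
  have h0 : (g * torus u).1 0 0 = g.1 0 0 * u := by
    simp [torus, Matrix.mul_apply, Fin.sum_univ_two]
  have h1 : (g * torus u).1 0 1 = g.1 0 1 * (u : ℂ)⁻¹ := by
    rw [← hu]
    simp [torus, Matrix.mul_apply, Fin.sum_univ_two]
  rw [rowMonomial, h0, h1, rowMonomial, zpow_sub₀ u.coe_ne_zero, mul_pow, mul_pow, inv_pow,
    zpow_natCast, zpow_natCast]
  ring

theorem hasDerivAt_rowMonomial (p q : ℕ) (g : SU2) (x : Fin 2 → ℝ) :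
    HasDerivAt (fun t : ℝ => rowMonomial p q (g * expM (t • x)))
      ((-x 0 + x 1 * Complex.I) * p * rowMonomial (p - 1) (q + 1) g +
        (x 0 + x 1 * Complex.I) * q * rowMonomial (p + 1) (q - 1) g) 0 := by
  have h (j : Fin 2) : HasDerivAt (fun t : ℝ => (g * expM (t • x)).1 0 j)
      (g.1 0 0 * mElem x 0 j + g.1 0 1 * mElem x 1 j) 0 := by
    have := ((hasDerivAt_expM_apply x 0 j).const_mul (g.1 0 0)).add
      ((hasDerivAt_expM_apply x 1 j).const_mul (g.1 0 1))
    refine this.congr_of_eventuallyEq (.of_forall fun t => ?_)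
    simp [Matrix.mul_apply, Fin.sum_univ_two]
  have e0 : g * expM ((0 : ℝ) • x) = g := by rw [zero_smul, expM_zero, mul_one]
  refine (((h 0).pow p).mul ((h 1).pow q)).congr_deriv ?_
  simp only [Pi.pow_apply, e0, rowMonomial, mElem_eq, Matrix.of_apply, Matrix.cons_val_zero,
    Matrix.cons_val_one]
  ring

/-! ### The Dirac operators on Hermite sections -/

/-- The section of the spinor bundle with coefficients `w` with respect to matrix coefficients
and Hermite functions. -/
noncomputable def hermiteSection (N M : ℕ) (w : ℕ → ℂ) (g : SU2) : L2R :=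
  ∑ k ∈ Finset.range (N + 1), (w k * rowMonomial (N - k) (M + k) g) • hermiteFun k

theorem hermiteSection_mem_spinorFields (κt : MetaplecticLift) {m : ℤ}
    (hm : ∀ (u : Circle) (k : ℕ), (κt.hom u : L2R ≃ₗᵢ[ℂ] L2R) (hermiteFun k) =
      ((u : ℂ) ^ (m + 2 * k)) • hermiteFun k) {N M : ℕ} (hNM : (M : ℤ) = N + m) (w : ℕ → ℂ) :
    hermiteSection N M w ∈ spinorFields κt := by
  refine ⟨⟨fun A => ∑ k ∈ Finset.range (N + 1),
    (w k * (A 0 0 ^ (N - k) * A 0 1 ^ (M + k))) • hermiteFun k, ?_, fun g => rfl⟩, fun g u => ?_⟩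
  · fun_prop
  · simp only [hermiteSection, map_sum, map_smul]
    refine Finset.sum_congr rfl fun k hk => ?_
    have hk' : k ≤ N := by have := Finset.mem_range.1 hk; omega
    rw [hm, rowMonomial_mul_torus, smul_smul, Circle.coe_inv, inv_zpow']
    congr 1
    have : ((N - k : ℕ) : ℤ) - (M + k : ℕ) = -(m + 2 * k) := by
      push_cast [Nat.cast_sub hk']
      linarith
    rw [this]
    ring

theorem spinorDeriv_hermiteSection (N M : ℕ) (w : ℕ → ℂ) (x : Fin 2 → ℝ) (g : SU2) :
    spinorDeriv x (hermiteSection N M w) g = ∑ k ∈ Finset.range (N + 1),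
      (w k * ((-x 0 + x 1 * Complex.I) * (N - k : ℕ) * rowMonomial (N - k - 1) (M + k + 1) g +
        (x 0 + x 1 * Complex.I) * (M + k : ℕ) * rowMonomial (N - k + 1) (M + k - 1) g)) •
        hermiteFun k := by
  refine HasDerivAt.deriv (HasDerivAt.fun_sum fun k _ => ?_)
  exact ((hasDerivAt_rowMonomial (N - k) (M + k) g x).const_mul (w k)).smul_const (hermiteFun k)

/-- In terms of raising and lowering operators, the Dirac operator given by `B` is
`c₂ · (raising) + c₁ · (lowering)`. -/
structure IsLadder (B : Matrix (Fin 2) (Fin 2) ℝ) (c₁ c₂ : ℂ) : Prop where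
  raise : ∀ P Q : ℂ, (-P + Q) * ((sharp B 0 0 * Complex.I - sharp B 0 1) / 2) +
    (P + Q) * Complex.I * ((sharp B 1 0 * Complex.I - sharp B 1 1) / 2) = c₂ * P
  lower : ∀ P Q : ℂ, (-P + Q) * (sharp B 0 0 * Complex.I + sharp B 0 1) +
    (P + Q) * Complex.I * (sharp B 1 0 * Complex.I + sharp B 1 1) = c₁ * Q

/-- On x^p y^q, with p = N - k and q = M + k, the derivatives along E₁ and E₂ are -P + Q and i(P +
Q), where P = p x^{p-1} y^{q+1} and Q = q x^{p+1} y^{q-1}. The ladder property leaves only P with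
h_{k+1} and only Q with h_{k-1}, so each monomial again meets its own Hermite function. -/
theorem isDirac_hermiteSection {B : Matrix (Fin 2) (Fin 2) ℝ} {c₁ c₂ : ℂ} (hB : IsLadder B c₁ c₂)
    (N M : ℕ) (w : ℕ → ℂ) :
    IsDirac B (hermiteSection N M w) fun g => ∑ k ∈ Finset.range (N + 1),
      ((w k * (c₂ * ((N - k : ℕ) * rowMonomial (N - k - 1) (M + k + 1) g))) • hermiteFun (k + 1) +
        (w k * (c₁ * ((M + k : ℕ) * rowMonomial (N - k + 1) (M + k - 1) g)) * k) •
          hermiteFun (k - 1)) := by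
  intro g
  simp only [spinorDeriv_hermiteSection]
  refine ⟨fun i => ∑ k ∈ Finset.range (N + 1), _, fun i => IsClifford.sum _ fun k _ =>
    (isClifford_hermiteFun (sharp B i) k).smul _, ?_⟩
  rw [Fin.sum_univ_two, ← Finset.sum_add_distrib]
  refine Finset.sum_congr rfl fun k _ => ?_
  rw [← hB.raise _ ((M + k : ℕ) * rowMonomial (N - k + 1) (M + k - 1) g),
    ← hB.lower ((N - k : ℕ) * rowMonomial (N - k - 1) (M + k + 1) g)]
  simp only [Pi.single_eq_same, Pi.single_apply, Fin.isValue, one_ne_zero, zero_ne_one, if_false,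
    Complex.ofReal_one, Complex.ofReal_zero]
  match_scalars <;> ring

theorem isDirac_hermiteSection_of_recurrence {B : Matrix (Fin 2) (Fin 2) ℝ} {c₁ c₂ : ℂ}
    (hB : IsLadder B c₁ c₂) (N M : ℕ) (w : ℕ → ℂ) (z : ℂ) (hw : w (N + 1) = 0)
    (h : ∀ k < N + 1, z * w k = c₁ * ((k + 1) * (M + k + 1)) * w (k + 1) +
      if k = 0 then 0 else c₂ * (N - (k - 1 : ℕ)) * w (k - 1)) :
    IsDirac B (hermiteSection N M w) (z • hermiteSection N M w) := by
  convert isDirac_hermiteSection hB N M w using 1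
  funext g
  rw [Pi.smul_apply, hermiteSection, Finset.smul_sum, Finset.sum_add_distrib]
  -- The raised top term k = N drops out because N - k = 0.
  have e1 : ∑ k ∈ Finset.range (N + 1), (w k * (c₂ * ((N - k : ℕ) *
      rowMonomial (N - k - 1) (M + k + 1) g))) • hermiteFun (k + 1) =
      ∑ k ∈ Finset.range (N + 1), ((if k = 0 then 0 else c₂ * (N - (k - 1 : ℕ)) * w (k - 1)) *
        rowMonomial (N - k) (M + k) g) • hermiteFun k := by
    rw [Finset.sum_range_succ, Finset.sum_range_succ']
    simp only [if_true, zero_mul, mul_zero, zero_smul, add_zero, Nat.sub_self, Nat.cast_zero, Nat.succ_ne_zero, if_false,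
      Nat.add_sub_cancel]
    refine Finset.sum_congr rfl fun k hk => ?_
    rw [Nat.cast_sub (Finset.mem_range.1 hk).le, Nat.sub_sub, add_assoc M]
    congr 1
    ring
  -- The lowered bottom term carries the factor k = 0; the term added at the top vanishes by `hw`.
  have e2 : ∑ k ∈ Finset.range (N + 1), (w k * (c₁ * ((M + k : ℕ) *
      rowMonomial (N - k + 1) (M + k - 1) g)) * k) • hermiteFun (k - 1) =
      ∑ k ∈ Finset.range (N + 1), ((c₁ * ((k + 1) * (M + k + 1)) * w (k + 1)) *
        rowMonomial (N - k) (M + k) g) • hermiteFun k := by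
    rw [Finset.sum_range_succ', Finset.sum_range_succ (n := N), hw]
    simp only [mul_zero, zero_mul, zero_smul, add_zero, Nat.cast_zero]
    refine Finset.sum_congr rfl fun k hk => ?_
    have hk' := Finset.mem_range.1 hk
    rw [show N - (k + 1) + 1 = N - k by omega, show M + (k + 1) - 1 = M + k by omega,
      Nat.add_sub_cancel]
    congr 1
    push_cast
    ring
  rw [e1, e2, ← Finset.sum_add_distrib]
  refine Finset.sum_congr rfl fun k hk => ?_
  rw [← add_smul, smul_smul, ← mul_assoc, h k (Finset.mem_range.1 hk)]
  congr 1
  ring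

theorem exists_row_ne_zero : ∃ g : SU2, g.1 0 0 ≠ 0 ∧ g.1 0 1 ≠ 0 := by
  refine ⟨⟨!![3 / 5, 4 / 5; -4 / 5, 3 / 5], ?_⟩, ?_, ?_⟩
  · rw [Matrix.mem_specialUnitaryGroup_iff, Matrix.mem_unitaryGroup_iff]
    refine ⟨?_, ?_⟩
    · ext i j
      fin_cases i <;> fin_cases j <;>
        simp [Matrix.mul_apply, Matrix.star_apply, Fin.sum_univ_two, map_ofNat] <;> norm_num
    · rw [Matrix.det_fin_two_of]
      norm_num
  · simp
  · simp

/-- At a point where both entries of the first row are nonzero, no monomial vanishes, and the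
Hermite functions are independent. -/
theorem hermiteSection_ne_zero {N M : ℕ} {w : ℕ → ℂ} {k : ℕ} (hk : k ≤ N) (hw : w k ≠ 0) :
    hermiteSection N M w ≠ 0 := by
  intro h
  obtain ⟨g, h0, h1⟩ := exists_row_ne_zero
  have := linearIndependent_iff'.1 linearIndependent_hermiteFun (Finset.range (N + 1)) _
    (congrFun h g) k (Finset.mem_range.2 (by omega))
  exact mul_ne_zero hw (mul_ne_zero (pow_ne_zero _ h0) (pow_ne_zero _ h1)) this

/-! ### Large eigenvalues and the spectrum -/

/-- The substitution w_k = γ^k v_k turns the recurrence for w into ε times a real one with positive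
coefficients; `h₁` and `h₂` are exactly what this requires. -/
theorem exists_diracEigenvalue (κt : MetaplecticLift) {B : Matrix (Fin 2) (Fin 2) ℝ} {c₁ c₂ : ℂ}
    (hB : IsLadder B c₁ c₂) {ε γ : ℂ} (hγ : γ ≠ 0) (h₁ : c₁ * γ = 2 * ε) (h₂ : c₂ = ε * γ) (R : ℝ) :
    ∃ r : ℝ, R < r ∧ ε * r ∈ diracEigenvalues κt B := by
  obtain ⟨m, hm⟩ := κt.exists_weight
  obtain ⟨a, ha⟩ := exists_nat_gt (R ^ 2)
  -- Here N = n + 1. Adding |m| keeps M = N + m nonnegative, and n ≥ a > R² forces √(2(M+1)(n+1)) >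
  -- R.
  obtain ⟨n, M, hn, hM⟩ : ∃ n M : ℕ, a ≤ n ∧ (M : ℤ) = (n + 1 : ℕ) + m :=
    ⟨a + m.natAbs, ((a + m.natAbs + 1 : ℕ) + m).toNat, by omega, by omega⟩
  have hpos : ∀ k ≤ n, (0 : ℝ) < (n + 1 : ℕ) - k := fun k hk => by
    rw [sub_pos]
    exact_mod_cast Nat.lt_succ_of_le hk
  obtain ⟨r, hr, v, ⟨k, hk⟩, hv0, hv⟩ := exists_eigenvalue_recurrence
    (fun k => 2 * ((k + 1) * (M + k + 1))) (fun k => (n + 1 : ℕ) - k) n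
    (fun k _ => by positivity) hpos
  have hkn : k ≤ n + 1 := by
    by_contra h
    exact hk (hv0 k (by omega))
  refine ⟨r, lt_of_lt_of_le (Real.lt_sqrt_of_sq_lt ?_) hr,
    hermiteSection (n + 1) M (fun k => γ ^ k * v k), hermiteSection_mem_spinorFields κt hm hM _,
    hermiteSection_ne_zero hkn (mul_ne_zero (pow_ne_zero _ hγ) (Complex.ofReal_ne_zero.2 hk)),
    isDirac_hermiteSection_of_recurrence hB _ _ _ _ ?_ fun k hk => ?_⟩
  · have h1 : (a : ℝ) ≤ n := by exact_mod_cast hn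
    have h2 : (0 : ℝ) ≤ M := M.cast_nonneg
    have h3 : (0 : ℝ) ≤ n := n.cast_nonneg
    push_cast
    nlinarith [mul_nonneg h2 h3]
  · simp [hv0 (n + 1 + 1) le_rfl]
  · have h := congrArg (fun x : ℝ => (x : ℂ)) (hv k hk)
    rcases k with _ | k
    · simp only [if_true, add_zero, pow_zero, one_mul, zero_add, pow_one] at h ⊢
      push_cast at h ⊢
      linear_combination ε * h - (M + 1) * (v 1 : ℂ) * h₁
    · simp only [Nat.succ_ne_zero, if_false, Nat.add_sub_cancel, pow_succ] at h ⊢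
      push_cast at h ⊢
      rw [h₂]
      linear_combination ε * γ ^ k * γ * h -
        γ ^ k * γ * ((k + 2) * (M + k + 2)) * (v (k + 1 + 1) : ℂ) * h₁

/-- A bounded inverse R of T - z would send 0 = zφ - zφ to the class of φ, making φ zero almost
everywhere. By continuity φ would vanish identically, since Haar measure charges every nonempty open
set. -/
theorem diracEigenvalues_subset_diracSpectrum (κt : MetaplecticLift)
    (B : Matrix (Fin 2) (Fin 2) ℝ) : diracEigenvalues κt B ⊆ diracSpectrum κt B := by
  rintro z ⟨φ, hφ, hne, hD⟩ ⟨R, -, hR⟩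
  have hcont : Continuous φ := by
    obtain ⟨F, hF, hFφ⟩ := hφ.1
    rw [funext hFφ]
    exact hF.continuous.comp (by fun_prop)
  have hmem : MemLp φ 2 (Measure.haar : Measure SU2) :=
    hcont.memLp_of_hasCompactSupport (HasCompactSupport.of_compactSpace φ)
  have hz : z • φ ∈ spinorFields κt := by
    obtain ⟨F, hF, hFφ⟩ := hφ.1
    refine ⟨⟨z • F, hF.const_smul z, fun g => by simp [hFφ g]⟩, fun g u => ?_⟩
    rw [Pi.smul_apply, hφ.2, Pi.smul_apply, map_smul]
  let u : spinorL2 κt := ⟨hmem.toLp φ,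
    subset_closure (Submodule.subset_span ⟨φ, hφ, hmem.coeFn_toLp⟩)⟩
  have hu : (u, z • u) ∈ diracGraph κt B := by
    refine ⟨φ, hφ, z • φ, hz, hD, hmem.coeFn_toLp, ?_⟩
    refine (Lp.coeFn_smul z (hmem.toLp φ)).trans ?_
    filter_upwards [hmem.coeFn_toLp] with g hg
    rw [Pi.smul_apply, Pi.smul_apply, hg]
  have h0 := hR _ (subset_closure hu)
  simp only [sub_self, map_zero] at h0
  have h1 : hmem.toLp φ = 0 := (congrArg Subtype.val h0).symm
  have h2 : φ =ᵐ[(Measure.haar : Measure SU2)] 0 := by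
    refine hmem.coeFn_toLp.symm.trans ?_
    rw [h1]
    exact Lp.coeFn_zero _ _ _
  exact hne ((hcont.ae_eq_iff_eq _ continuous_zero).1 h2)

theorem isLadder_omega0 : IsLadder omega0 (-2) (-1) := by
  have h : omega0⁻¹ = !![0, -1; 1, 0] := by
    refine Matrix.inv_eq_right_inv ?_
    ext i j
    fin_cases i <;> fin_cases j <;> simp [omega0]
  constructor <;> intro P Q <;> simp [sharp, h] <;> ring_nf <;> simp <;> ring

theorem isLadder_g0 : IsLadder g0 (2 * Complex.I) (-Complex.I) := by
  have h : g0⁻¹ = 1 := by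
    refine Matrix.inv_eq_right_inv ?_
    ext i j
    fin_cases i <;> fin_cases j <;> simp [g0, omega0, J0]
  constructor <;> intro P Q <;> simp [sharp, h] <;> ring

theorem not_bddAbove_and_not_bddBelow_of_isLadder (κt : MetaplecticLift)
    {B : Matrix (Fin 2) (Fin 2) ℝ} {c₁ c₂ γ : ℂ} (hB : IsLadder B c₁ c₂) (hγ : γ ≠ 0)
    (h₁ : c₁ * γ = 2) (h₂ : c₂ = γ) {S : Set ℂ} (hS : diracEigenvalues κt B ⊆ S) :
    ¬ BddAbove {r : ℝ | (r : ℂ) ∈ S} ∧ ¬ BddBelow {r : ℝ | (r : ℂ) ∈ S} := by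
  rw [not_bddAbove_iff, not_bddBelow_iff]
  refine ⟨fun R => ?_, fun R => ?_⟩
  · obtain ⟨r, hr, h⟩ := exists_diracEigenvalue κt hB hγ (ε := 1) (by rw [h₁, mul_one])
      (by rw [h₂, one_mul]) R
    exact ⟨r, hS (by simpa using h), hr⟩
  -- Replacing γ by -γ multiplies w_k by (-1)^k, which reverses the sign of the eigenvalue.
  · obtain ⟨r, hr, h⟩ := exists_diracEigenvalue κt hB (neg_ne_zero.2 hγ) (ε := -1)
      (by rw [mul_neg, h₁, mul_neg, mul_one]) (by rw [h₂]; ring) (-R)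
    exact ⟨-r, hS (by simpa using h), by linarith⟩

end CP1

theorem mainTheorem6 (κt : CP1.MetaplecticLift) :
    (¬ BddAbove {r : ℝ | (r : ℂ) ∈ CP1.diracSpectrum κt CP1.omega0} ∧
      ¬ BddBelow {r : ℝ | (r : ℂ) ∈ CP1.diracSpectrum κt CP1.omega0}) ∧
    (¬ BddAbove {r : ℝ | (r : ℂ) ∈ CP1.diracSpectrum κt CP1.g0} ∧
      ¬ BddBelow {r : ℝ | (r : ℂ) ∈ CP1.diracSpectrum κt CP1.g0}) ∧
    (¬ BddAbove {r : ℝ | (r : ℂ) ∈ CP1.diracEigenvalues κt CP1.omega0} ∧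
      ¬ BddBelow {r : ℝ | (r : ℂ) ∈ CP1.diracEigenvalues κt CP1.omega0}) ∧
    (¬ BddAbove {r : ℝ | (r : ℂ) ∈ CP1.diracEigenvalues κt CP1.g0} ∧
      ¬ BddBelow {r : ℝ | (r : ℂ) ∈ CP1.diracEigenvalues κt CP1.g0}) := by
  have hω {S : Set ℂ} := CP1.not_bddAbove_and_not_bddBelow_of_isLadder κt CP1.isLadder_omega0
    (γ := -1) (by simp) (by norm_num) rfl (S := S)
  have hg {S : Set ℂ} := CP1.not_bddAbove_and_not_bddBelow_of_isLadder κt CP1.isLadder_g0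
    (γ := -Complex.I) (by simp) (by linear_combination (-2 : ℂ) * Complex.I_mul_I) rfl (S := S)
  exact ⟨hω (CP1.diracEigenvalues_subset_diracSpectrum κt _),
    hg (CP1.diracEigenvalues_subset_diracSpectrum κt _), hω subset_rfl, hg subset_rfl⟩
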